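/- **Setting.** A \emph{social environment} is $\mathscr S=\langle I,O,(\succcurlyeq_i)_{i\in I},(\to_J)_{\emptyset\ne J\subseteq I}\rangle$ with a finite set $I$ of players, a finite set $O$ of outcomes, for every player $i$ a complete and transitive relation $\succcurlyeq_i$ on $O$, and for every coalition $J$ (nonempty set of players) an arbitrary effectiveness relation $\to_J\subseteq O\times O$. Fix an initial status quo $o^*\in O$. The \emph{derived dynamic ordinal game with $N$ stages} is played as follows. At a stage with status quo $o$ the set $M(o)$ of feasible moves consists of all $o\to_J o'$ that hold, and of the no-move $o\to_\emptyset o$. Simultaneously, a dummy individual $0$ chooses a permutation (an ordering) of $M(o)$ and every player $i\in I$ chooses a function $M(o)\to\{0,1\}$ ($1$: agree, $0$: block). The first move $o\to_J o'$ ($J\ne\emptyset$) in the chosen order to which all members of $J$ agree is implemented and $o'$ becomes the new status quo; the no-move, which keeps the status quo $o$, is implemented either (convention 1) only if every move of a coalition is blocked, or (convention 2) as soon as it is reached in the order. All actions are observed. After exactly $N$ stages the game ends, and player $i$ ranks terminal histories by applying $\succcurlyeq_i$ to the final status quo. A strategy is a class of behaviorally equivalent complete contingent plans (plans that allow the same histories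 and prescribe the same actions at these); $S_j$ is the set of strategies of $j\in I\cup\{0\}$, $S=\prod_j S_j$, and $\zeta$ maps strategy profiles to terminal histories. **Iterative Conditional B-Dominance (ICBD).** For a product set $R=\prod_j R_j\subseteq S$, a player $i$ and a nonterminal history $h$, let $R_i(h)$ and $R_{-i}(h)$ be the sets of those elements of $R_i$ and of $R_{-i}=\prod_{j\neq i}R_j$ that allow $h$ to be reached. Let $\mathbb U_i(R)$ be the set of all $s_i\in R_i$ such that for every nonterminal $h$ allowed by $s_i$ with $R_i(h)\times R_{-i}(h)\ne\emptyset$ there is a nonempty product set $Q_{-i}\subseteq R_{-i}(h)$ against which $s_i$ is not weakly dominated by any strategy in $R_i(h)$. Put $\mathbb U_0(R)=R_0$ for the dummy individual, $\mathbb U(R)=\prod_j\mathbb U_j(R)$, $\mathbb U^0(S)=S$, $\mathbb U^{n+1}(S)=\mathbb U(\mathbb U^n(S))$ and $\mathbb U^\infty(S)=\bigcap_n\mathbb U^n(S)$. Let $Z^\infty[k]\subseteq O$ be the set of final status quos of the terminal histories $\zeta(s)$, $s\in\mathbb U^\infty(S)$, in the game with $k+1$ stages. The set of \emph{ordinally socially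 rationalizable outcomes} is $$Z^\infty=\limsup_{k\to\infty}Z^\infty[k]=\bigcap_{m}\bigcup_{k\ge m}Z^\infty[k].$$ **Proposition.** For every social environment $\mathscr S$ and every initial status quo $o^*\in O$, and under either convention for the no-move, $Z^\infty\neq\emptyset$. -/

import Mathlib

universe u v

/-- A social environment: for every player in `I` a complete and transitive preference relation
over the outcomes in `O` (`pref i o o'` means that `i` weakly prefers `o` to `o'`), and for every
coalition (nonempty set of players) an arbitrary effectiveness relation over outcomes. -/
structure SocialEnvironment (I : Type u) (O : Type v) where
  pref : I → O → O → Prop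
  pref_total : ∀ (i : I) (o o' : O), pref i o o' ∨ pref i o' o
  pref_trans : ∀ (i : I) (o o' o'' : O), pref i o o' → pref i o' o'' → pref i o o''
  eff : {J : Finset I // J.Nonempty} → O → O → Prop

/-- The two conventions for the no-move, whose coalition is empty and which nobody can block:
* `fallback`: it is implemented exactly if every move of a (nonempty) coalition is blocked;
* `inOrder`: it is treated like the other moves, that is, it is implemented as soon as it is
  reached in the order of the moves. -/
inductive NoMoveRule where
  | fallback
  | inOrder

namespace SocialEnvironment

variable {I : Type u} {O : Type v}

/-- The feasible moves at status quo `o`: the moves from `o` to `o'` of the coalitions that are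
effective for it, and the no-move. -/
inductive Move (E : SocialEnvironment I O) (o : O) : Type (max u v) where
  | move (J : {J : Finset I // J.Nonempty}) (o' : O) (h : E.eff J o o') : Move E o
  | stay : Move E o

/-- The status quo that results from a move. -/
def Move.target {E : SocialEnvironment I O} {o : O} : E.Move o → O
  | .move _ o' _ => o'
  | .stay => o

/-- The actions at status quo `o`. The dummy individual `none` chooses a permutation of the
feasible moves (a list in which each of them occurs exactly once); a player `some i` chooses, for
every feasible move, whether to agree to it (`true`) or to block it (`false`). -/
def Act (E : SocialEnvironment I O) (o : O) : Option I → Type (max u v)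
  | none => {l : List (E.Move o) // l.Nodup ∧ ∀ m, m ∈ l}
  | some _ => ULift.{max u v} (E.Move o → Bool)

/-- A profile of actions of the dummy individual and the players at status quo `o`. -/
abbrev ActProfile (E : SocialEnvironment I O) (o : O) : Type (max u v) :=
  ∀ j : Option I, E.Act o j

/-- The list of the feasible moves, in the order chosen by the dummy individual. -/
def order {E : SocialEnvironment I O} {o : O} (a : E.ActProfile o) : List (E.Move o) :=
  (a none : {l : List (E.Move o) // l.Nodup ∧ ∀ m, m ∈ l}).1

/-- The vote of player `i` on the move `m`. -/
def vote {E : SocialEnvironment I O} {o : O} (a : E.ActProfile o) (i : I) (m : E.Move o) : Bool :=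
  (a (some i) : ULift.{max u v} (E.Move o → Bool)).down m

/-- A move is carried if no member of its coalition blocks it. Nobody can block the no-move; under
the convention `fallback` it is not put to the vote. -/
def Carried {E : SocialEnvironment I O} (c : NoMoveRule) {o : O} (a : E.ActProfile o) :
    E.Move o → Prop
  | .move J o' h => ∀ i ∈ J.1, vote a i (.move J o' h) = true
  | .stay => c = .inOrder

open Classical in
/-- The move that is implemented: the first carried move in the chosen order, and the no-move if
there is none. -/
noncomputable def implemented {E : SocialEnvironment I O} (c : NoMoveRule) {o : O}
    (a : E.ActProfile o) : E.Move o :=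
  ((order a).find? fun m => decide (Carried c a m)).getD .stay

/-- Histories of length `k` together with the map that assigns to them the resulting status quo. -/
noncomputable def histAux (E : SocialEnvironment I O) (c : NoMoveRule) (o₀ : O) :
    ℕ → Σ X : Type (max u v), X → O
  | 0 => ⟨PUnit, fun _ => o₀⟩
  | k + 1 => ⟨Σ x : (histAux E c o₀ k).1, E.ActProfile ((histAux E c o₀ k).2 x),
      fun p => (implemented c p.2).target⟩

/-- The histories `(a¹, …, aᵏ)` of length `k`, with initial status quo `o₀`. -/
def Hist (E : SocialEnvironment I O) (c : NoMoveRule) (o₀ : O) (k : ℕ) : Type (max u v) :=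
  (histAux E c o₀ k).1

/-- The status quo after a history. -/
noncomputable def statusQuo (E : SocialEnvironment I O) (c : NoMoveRule) (o₀ : O) {k : ℕ}
    (x : E.Hist c o₀ k) : O :=
  (histAux E c o₀ k).2 x

/-- The nonterminal histories of the game with `N` stages, that is, those of length `k < N`.
Actions are observable and every player has at least two actions at each of them, hence they are
(as singletons) the information sets of every player. -/
abbrev Node (E : SocialEnvironment I O) (c : NoMoveRule) (o₀ : O) (N : ℕ) : Type (max u v) :=
  Σ k : Fin N, E.Hist c o₀ k

/-- Standard strategies (complete contingent plans) of an individual. -/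
abbrev StdStrat (E : SocialEnvironment I O) (c : NoMoveRule) (o₀ : O) (N : ℕ) (j : Option I) :
    Type (max u v) :=
  ∀ h : E.Node c o₀ N, E.Act (E.statusQuo c o₀ h.2) j

/-- The history of length `k` that a profile of standard strategies leads to. -/
noncomputable def play {E : SocialEnvironment I O} {c : NoMoveRule} {o₀ : O} {N : ℕ}
    (s : ∀ j, E.StdStrat c o₀ N j) : ∀ k : ℕ, k ≤ N → E.Hist c o₀ k
  | 0, _ => PUnit.unit
  | k + 1, hk =>
    let x := play s k (Nat.le_of_succ_le hk)
    ⟨x, fun j => s j ⟨⟨k, hk⟩, x⟩⟩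

/-- The standard strategy `s` allows the nonterminal history `h`: together with suitable strategies
of the other individuals it reaches `h`. -/
def StdAllows {E : SocialEnvironment I O} {c : NoMoveRule} {o₀ : O} {N : ℕ} {j : Option I}
    (s : E.StdStrat c o₀ N j) (h : E.Node c o₀ N) : Prop :=
  ∃ t : ∀ j, E.StdStrat c o₀ N j, t j = s ∧ play t h.1 h.1.2.le = h.2

/-- Behavioral equivalence: the two standard strategies allow the same histories and prescribe the
same actions at these. -/
def behavioral (E : SocialEnvironment I O) (c : NoMoveRule) (o₀ : O) (N : ℕ) (j : Option I) :
    Setoid (E.StdStrat c o₀ N j) where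
  r s t := (∀ h, StdAllows s h ↔ StdAllows t h) ∧ ∀ h, StdAllows s h → s h = t h
  iseqv :=
    { refl := fun _ => ⟨fun _ => Iff.rfl, fun _ _ => rfl⟩
      symm := fun hst => ⟨fun h => (hst.1 h).symm, fun h ht => (hst.2 h ((hst.1 h).2 ht)).symm⟩
      trans := fun hst htr => ⟨fun h => (hst.1 h).trans (htr.1 h),
        fun h hs => (hst.2 h hs).trans (htr.2 h ((hst.1 h).1 hs))⟩ }

/-- Strategies: classes of behaviorally equivalent standard strategies. -/
def Strat (E : SocialEnvironment I O) (c : NoMoveRule) (o₀ : O) (N : ℕ) (j : Option I) :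
    Type (max u v) :=
  Quotient (E.behavioral c o₀ N j)

/-- Strategy profiles (including the dummy individual). -/
abbrev Profile (E : SocialEnvironment I O) (c : NoMoveRule) (o₀ : O) (N : ℕ) : Type (max u v) :=
  ∀ j : Option I, E.Strat c o₀ N j

/-- Strategy profiles of all individuals other than `i` (including the dummy individual). -/
abbrev Others (E : SocialEnvironment I O) (c : NoMoveRule) (o₀ : O) (N : ℕ) (i : Option I) :
    Type (max u v) :=
  ∀ j : {j : Option I // j ≠ i}, E.Strat c o₀ N j

/-- The history of length `k` that a strategy profile leads to (independent of representatives by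
`path_mk`). -/
noncomputable def path {E : SocialEnvironment I O} {c : NoMoveRule} {o₀ : O} {N : ℕ}
    (s : E.Profile c o₀ N) (k : ℕ) (hk : k ≤ N) : E.Hist c o₀ k :=
  play (fun j => Quotient.out (s j)) k hk

theorem play_congr {E : SocialEnvironment I O} {c : NoMoveRule} {o₀ : O} {N : ℕ}
    {s t : ∀ j, E.StdStrat c o₀ N j} (hst : ∀ j, E.behavioral c o₀ N j (s j) (t j)) :
    ∀ (k : ℕ) (hk : k ≤ N), play s k hk = play t k hk
  | 0, _ => rfl
  | k + 1, hk => by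
    have ih := play_congr hst k (Nat.le_of_succ_le hk)
    have key : ∀ j, s j ⟨⟨k, hk⟩, play s k (Nat.le_of_succ_le hk)⟩
        = t j ⟨⟨k, hk⟩, play s k (Nat.le_of_succ_le hk)⟩ :=
      fun j => (hst j).2 _ ⟨s, rfl, rfl⟩
    simp only [play]
    rw [← ih]
    exact congrArg (Sigma.mk _) (funext key)

theorem path_mk {E : SocialEnvironment I O} {c : NoMoveRule} {o₀ : O} {N : ℕ}
    (s : ∀ j, E.StdStrat c o₀ N j) (k : ℕ) (hk : k ≤ N) :
    path (fun j => (Quotient.mk _ (s j) : E.Strat c o₀ N j)) k hk = play s k hk :=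
  play_congr (fun j => Quotient.exact (Quotient.out_eq (Quotient.mk (E.behavioral c o₀ N j) (s j))))
    k hk

/-- The outcome function: the terminal history that a strategy profile leads to. -/
noncomputable def zeta {E : SocialEnvironment I O} {c : NoMoveRule} {o₀ : O} {N : ℕ}
    (s : E.Profile c o₀ N) : E.Hist c o₀ N :=
  path s N le_rfl

/-- The strategy profiles that reach the nonterminal history `h`. -/
def reach {E : SocialEnvironment I O} {c : NoMoveRule} {o₀ : O} {N : ℕ} (h : E.Node c o₀ N) :
    Set (E.Profile c o₀ N) :=
  {s | path s h.1 h.1.2.le = h.2}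

/-- The strategies of `i` that reach (allow) `h`: a projection of `reach h`. -/
def reachOwn {E : SocialEnvironment I O} {c : NoMoveRule} {o₀ : O} {N : ℕ} (i : Option I)
    (h : E.Node c o₀ N) : Set (E.Strat c o₀ N i) :=
  (fun s => s i) '' reach h

/-- The profiles of the others that reach (allow) `h`: a projection of `reach h`. -/
def reachOthers {E : SocialEnvironment I O} {c : NoMoveRule} {o₀ : O} {N : ℕ} (i : Option I)
    (h : E.Node c o₀ N) : Set (E.Others c o₀ N i) :=
  (fun s (j : {j : Option I // j ≠ i}) => s j) '' reach h

open Classical in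
/-- The strategy profile made up of a strategy of `i` and a profile of the others. -/
noncomputable def join {E : SocialEnvironment I O} {c : NoMoveRule} {o₀ : O} {N : ℕ} {i : Option I}
    (s : E.Strat c o₀ N i) (t : E.Others c o₀ N i) : E.Profile c o₀ N :=
  (Equiv.piSplitAt i (E.Strat c o₀ N)).symm (s, t)

/-- Preference of player `i` over terminal histories: the last status quo is implemented. -/
def HistPref {E : SocialEnvironment I O} {c : NoMoveRule} {o₀ : O} {N : ℕ} (i : I)
    (z z' : E.Hist c o₀ N) : Prop :=
  E.pref i (E.statusQuo c o₀ z) (E.statusQuo c o₀ z')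

/-- `s'` weakly dominates `s` against the set `Q` of profiles of the others. -/
def WeaklyDominates {E : SocialEnvironment I O} {c : NoMoveRule} {o₀ : O} {N : ℕ} (i : I)
    (Q : Set (E.Others c o₀ N (some i))) (s' s : E.Strat c o₀ N (some i)) : Prop :=
  (∀ t ∈ Q, HistPref i (zeta (join s' t)) (zeta (join s t))) ∧
    ∃ t ∈ Q, HistPref i (zeta (join s' t)) (zeta (join s t)) ∧
      ¬ HistPref i (zeta (join s t)) (zeta (join s' t))

/-- The strategies of player `i` that are admissible with respect to `P × Q`. -/
def admissible {E : SocialEnvironment I O} {c : NoMoveRule} {o₀ : O} {N : ℕ} (i : I)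
    (P : Set (E.Strat c o₀ N (some i))) (Q : Set (E.Others c o₀ N (some i))) :
    Set (E.Strat c o₀ N (some i)) :=
  {s ∈ P | ∀ s' ∈ P, ¬ WeaklyDominates i Q s' s}

/-- The strategies of player `i` that are B-dominated with respect to `P × T`: those in `P` that are
not admissible with respect to `P × Q`, for every nonempty product set `Q ⊆ T`. -/
def bDominated {E : SocialEnvironment I O} {c : NoMoveRule} {o₀ : O} {N : ℕ} (i : I)
    (P : Set (E.Strat c o₀ N (some i))) (T : Set (E.Others c o₀ N (some i))) :
    Set (E.Strat c o₀ N (some i)) :=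
  {s ∈ P | ∀ Q : ∀ j : {j : Option I // j ≠ some i}, Set (E.Strat c o₀ N j),
    (Set.univ.pi Q).Nonempty → Set.univ.pi Q ⊆ T → s ∉ admissible i P (Set.univ.pi Q)}

/-- `Rᵢ(h)`, for a product set `R` of strategy profiles, given by its factors. -/
def restrictOwn {E : SocialEnvironment I O} {c : NoMoveRule} {o₀ : O} {N : ℕ}
    (R : ∀ j, Set (E.Strat c o₀ N j)) (i : Option I) (h : E.Node c o₀ N) :
    Set (E.Strat c o₀ N i) :=
  R i ∩ reachOwn i h

/-- `R₋ᵢ(h)`, for a product set `R` of strategy profiles, given by its factors. -/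
def restrictOthers {E : SocialEnvironment I O} {c : NoMoveRule} {o₀ : O} {N : ℕ}
    (R : ∀ j, Set (E.Strat c o₀ N j)) (i : Option I) (h : E.Node c o₀ N) :
    Set (E.Others c o₀ N i) :=
  (Set.univ.pi fun j : {j : Option I // j ≠ i} => R j) ∩ reachOthers i h

/-- The strategies in `Rᵢ` that are not conditionally B-dominated with respect to `R`. -/
def undominated {E : SocialEnvironment I O} {c : NoMoveRule} {o₀ : O} {N : ℕ}
    (R : ∀ j, Set (E.Strat c o₀ N j)) (i : I) : Set (E.Strat c o₀ N (some i)) :=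
  {s ∈ R (some i) | ∀ h : E.Node c o₀ N, s ∈ reachOwn (some i) h →
    (restrictOwn R (some i) h ×ˢ restrictOthers R (some i) h).Nonempty →
      s ∉ bDominated i (restrictOwn R (some i) h) (restrictOthers R (some i) h)}

/-- One round of elimination, for all players simultaneously. The dummy individual has no
preferences; its strategies are never eliminated. -/
def reduce {E : SocialEnvironment I O} {c : NoMoveRule} {o₀ : O} {N : ℕ}
    (R : ∀ j, Set (E.Strat c o₀ N j)) : ∀ j, Set (E.Strat c o₀ N j)
  | none => R none
  | some i => undominated R i

/-- Iterative Conditional B-Dominance: the factors of the set of strategy profiles that survive `n`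
rounds. -/
def icbdStep (E : SocialEnvironment I O) (c : NoMoveRule) (o₀ : O) (N : ℕ) :
    ℕ → ∀ j, Set (E.Strat c o₀ N j)
  | 0 => fun _ => Set.univ
  | n + 1 => reduce (icbdStep E c o₀ N n)

/-- The strategy profiles that survive Iterative Conditional B-Dominance in the game with `N`
stages. -/
def icbd (E : SocialEnvironment I O) (c : NoMoveRule) (o₀ : O) (N : ℕ) :
    Set (E.Profile c o₀ N) :=
  ⋂ n : ℕ, Set.univ.pi (icbdStep E c o₀ N n)

/-- The outcomes (last status quos) induced by the strategy profiles that survive Iterative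
Conditional B-Dominance in the game with `k + 1` stages. -/
def icbdOutcomes (E : SocialEnvironment I O) (c : NoMoveRule) (o₀ : O) (k : ℕ) : Set O :=
  (fun z => E.statusQuo c o₀ z) '' (zeta '' E.icbd c o₀ (k + 1))

/-- The ordinally socially rationalizable outcomes: the upper limit, in the sense of sets, of the
outcomes that survive in the game with `k + 1` stages. -/
def sociallyRationalizable (E : SocialEnvironment I O) (c : NoMoveRule) (o₀ : O) : Set O :=
  Filter.limsup (fun k : ℕ => E.icbdOutcomes c o₀ k) Filter.atTop

end SocialEnvironment

/-! Only finiteness, observed actions and rational preferences matter; the voting rule plays no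
role. Fix `n` and a player `i`. At each history choose opponents who survive as many rounds, up to
`n`, as the history permits, together with a best reply of `i` among all strategies reaching it.
Keep this conjecture until it is contradicted (`conjecture`), and let `i` always play the
conjectured reply (`follow`). Wherever it reaches, this strategy does as well as a best reply to the
current conjecture (`zeta_join_follow`). It is hence undominated against a singleton of surviving
opponents, and by induction it survives `n` rounds (`icbdStep_nonempty`). The strategy sets are
finite, so the decreasing survivor sets have nonempty intersection. Since `O` is finite, the limsup
of nonempty sets of outcomes is nonempty. -/

namespace SocialEnvironment

variable {I : Type u} {O : Type v} {E : SocialEnvironment I O} {c : NoMoveRule} {o₀ : O} {N : ℕ}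

/-! ### Finiteness of moves, actions, histories and strategies. -/

instance finite_move [Finite I] [Finite O] (o : O) : Finite (E.Move o) := by
  classical
  let f : E.Move o → Option ({J : Finset I // J.Nonempty} × O) := fun m =>
    match m with
    | .move J o' _ => some (J, o')
    | .stay => none
  refine Finite.of_injective f ?_
  rintro (⟨J, o', h⟩ | _) (⟨J', o'', h'⟩ | _) hm
  · obtain ⟨rfl, rfl⟩ : J = J' ∧ o' = o'' := by simpa [f] using hm
    rfl
  · simp [f] at hm
  · simp [f] at hm
  · rfl

instance finite_act [Finite I] [Finite O] (o : O) (j : Option I) : Finite (E.Act o j) := by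
  classical
  cases j with
  | none =>
    have := Fintype.ofFinite (E.Move o)
    refine Set.Finite.subset (s := {l : List (E.Move o) | l.length ≤ Fintype.card (E.Move o)})
      (List.finite_length_le _ _) fun l hl => ?_
    exact List.Nodup.length_le_card hl.1
  | some i =>
    exact inferInstanceAs (Finite (ULift (E.Move o → Bool)))

instance nonempty_act [Finite I] [Finite O] (o : O) (j : Option I) : Nonempty (E.Act o j) := by
  classical
  cases j with
  | none =>
    have := Fintype.ofFinite (E.Move o)
    exact ⟨⟨Finset.univ.toList, Finset.nodup_toList _, by simp⟩⟩
  | some i => exact ⟨ULift.up fun _ => true⟩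

instance finite_hist [Finite I] [Finite O] (k : ℕ) : Finite (E.Hist c o₀ k) := by
  induction k with
  | zero => exact inferInstanceAs (Finite PUnit)
  | succ k ih =>
    exact inferInstanceAs
      (Finite (Σ x : E.Hist c o₀ k, E.ActProfile (E.statusQuo c o₀ x)))

instance finite_strat [Finite I] [Finite O] (j : Option I) : Finite (E.Strat c o₀ N j) :=
  inferInstanceAs (Finite (Quotient (E.behavioral c o₀ N j)))

instance nonempty_strat [Finite I] [Finite O] (j : Option I) : Nonempty (E.Strat c o₀ N j) :=
  ⟨Quotient.mk _ fun _ => Classical.arbitrary _⟩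

/-! ### Reachability of histories and recombination of profiles. -/

theorem play_succ_eq_iff {s t : ∀ j, E.StdStrat c o₀ N j} {k : ℕ} (hk : k + 1 ≤ N) :
    play s (k + 1) hk = play t (k + 1) hk ↔
      play s k (Nat.le_of_succ_le hk) = play t k (Nat.le_of_succ_le hk) ∧
        ∀ j, s j ⟨⟨k, hk⟩, play t k (Nat.le_of_succ_le hk)⟩ =
          t j ⟨⟨k, hk⟩, play t k (Nat.le_of_succ_le hk)⟩ := by
  simp only [play]
  generalize play s k (Nat.le_of_succ_le hk) = x
  generalize play t k (Nat.le_of_succ_le hk) = y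
  constructor
  · intro h
    obtain ⟨rfl, h⟩ := Sigma.mk.inj h
    exact ⟨rfl, congrFun (eq_of_heq h)⟩
  · rintro ⟨rfl, h⟩
    exact congrArg (Sigma.mk _) (funext h)

/-- A profile each of whose components is taken from one of two profiles that lead to the same
history leads to this history, too. -/
theorem play_mix {s t r : ∀ j, E.StdStrat c o₀ N j} (hr : ∀ j, r j = s j ∨ r j = t j) :
    ∀ (k : ℕ) (hk : k ≤ N), play s k hk = play t k hk → play r k hk = play t k hk
  | 0, _, _ => rfl
  | k + 1, hk, h => by
    rw [play_succ_eq_iff] at h ⊢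
    refine ⟨play_mix hr k _ h.1, fun j => ?_⟩
    rcases hr j with hj | hj
    · rw [hj, h.2 j]
    · rw [hj]

theorem mem_reach_mix {s t r : E.Profile c o₀ N} {h : E.Node c o₀ N}
    (hr : ∀ j, r j = s j ∨ r j = t j) (hs : s ∈ reach h) (ht : t ∈ reach h) : r ∈ reach h := by
  refine (play_mix (fun j => ?_) h.1 h.1.2.le (hs.trans ht.symm)).trans ht
  rcases hr j with hj | hj <;> simp [hj]

theorem join_self {i : Option I} (s : E.Strat c o₀ N i) (t : E.Others c o₀ N i) :
    join s t i = s := by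
  simp [join, Equiv.piSplitAt]

theorem join_of_ne {i j : Option I} (hj : j ≠ i) (s : E.Strat c o₀ N i) (t : E.Others c o₀ N i) :
    join s t j = t ⟨j, hj⟩ := by
  simp [join, Equiv.piSplitAt, hj]

/-- Perfect observation makes `reach h` a product set: mixing the components of two profiles that
reach `h` cannot leave the path to `h`. -/
theorem join_mem_reach {i : Option I} {s : E.Strat c o₀ N i} {t : E.Others c o₀ N i}
    {h : E.Node c o₀ N} (hs : s ∈ reachOwn i h) (ht : t ∈ reachOthers i h) :
    join s t ∈ reach h := by
  obtain ⟨p, hp, rfl⟩ := hs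
  obtain ⟨q, hq, rfl⟩ := ht
  refine mem_reach_mix (fun j => ?_) hp hq
  by_cases hj : j = i
  · subst hj; exact .inl (join_self _ _)
  · exact .inr (join_of_ne hj _ _)

/-- A profile that leads to a given history of length `k`. -/
theorem exists_play_eq [Finite I] [Finite O] :
    ∀ (k : ℕ) (hk : k ≤ N) (x : E.Hist c o₀ k), ∃ s : ∀ j, E.StdStrat c o₀ N j, play s k hk = x
  | 0, _, _ => ⟨fun _ _ => Classical.arbitrary _, rfl⟩
  | k + 1, hk, ⟨x, a⟩ => by
    classical
    obtain ⟨s, rfl⟩ := exists_play_eq k (Nat.le_of_succ_le hk) x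
    let n : E.Node c o₀ N := ⟨⟨k, hk⟩, play s k (Nat.le_of_succ_le hk)⟩
    -- Changing `s` only at the node `n` of length `k` leaves the path up to that node intact.
    let t : ∀ j, E.StdStrat c o₀ N j := fun j => Function.update (s j) n (a j)
    have ht : ∀ (l : ℕ) (hl : l ≤ k), play t l (hl.trans (Nat.le_of_succ_le hk)) =
        play s l (hl.trans (Nat.le_of_succ_le hk)) := by
      intro l
      induction l with
      | zero => intro _; rfl
      | succ l ih =>
        intro hl
        rw [play_succ_eq_iff]
        refine ⟨ih (Nat.le_of_succ_le hl), fun j => Function.update_of_ne ?_ _ _⟩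
        intro hn
        have : l = k := congrArg (fun m : E.Node c o₀ N => (m.1 : ℕ)) hn
        omega
    have hs : ∀ j, t j n = a j := fun j => Function.update_self _ _ _
    refine ⟨t, ?_⟩
    -- The history is generalized to `y` because the types of the actions depend on it.
    have : ∀ y (hy : y = play s k (Nat.le_of_succ_le hk)),
        (⟨y, fun j => t j ⟨⟨k, hk⟩, y⟩⟩ : E.Hist c o₀ (k + 1)) =
          (⟨play s k (Nat.le_of_succ_le hk), a⟩ : (histAux E c o₀ (k + 1)).1) := by
      rintro _ rfl
      exact congrArg (Sigma.mk _) (funext hs)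
    exact this _ (ht k le_rfl)

theorem reach_nonempty [Finite I] [Finite O] (h : E.Node c o₀ N) : (reach h).Nonempty := by
  obtain ⟨s, hs⟩ := exists_play_eq h.1 h.1.2.le h.2
  exact ⟨fun j => Quotient.mk _ (s j), (path_mk s h.1 h.1.2.le).trans hs⟩

/-! ### Optimal replies and conjectures. -/

theorem exists_pref_max [Finite O] (E : SocialEnvironment I O) (i : I) (A : Set O)
    (hA : A.Nonempty) : ∃ o ∈ A, ∀ o' ∈ A, E.pref i o o' := by
  let _ : Preorder O :=
    { le := fun o o' => E.pref i o' o
      le_refl := fun o => (E.pref_total i o o).elim id id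
      le_trans := fun a b d hab hbd => E.pref_trans i d b a hbd hab }
  obtain ⟨o, ho⟩ := A.toFinite.exists_maximal hA
  exact ⟨o, ho.1, fun o' ho' => (E.pref_total i o o').elim id fun h => ho.2 ho' h⟩

/-- `p` is a profile that reaches `h` in which `i` replies optimally to the others, among the
strategies that reach `h`. -/
def OptimalAt (i : I) (h : E.Node c o₀ N) (p : E.Profile c o₀ N) : Prop :=
  p ∈ reach h ∧ ∀ r ∈ reachOwn (some i) h,
    HistPref i (zeta p) (zeta (join r fun j : {j // j ≠ some i} => p j))

theorem exists_optimalAt [Finite O] (i : I) {h : E.Node c o₀ N} {t : E.Others c o₀ N (some i)}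
    (ht : t ∈ reachOthers (some i) h) :
    ∃ p, OptimalAt i h p ∧ (fun j : {j // j ≠ some i} => p j) = t := by
  have hne : (reachOwn (some i) h).Nonempty := by
    obtain ⟨p, hp, -⟩ := ht
    exact ⟨_, p, hp, rfl⟩
  obtain ⟨_, ⟨s, hs, rfl⟩, hmax⟩ := exists_pref_max E i
    ((fun s => E.statusQuo c o₀ (zeta (join s t))) '' reachOwn (some i) h) (hne.image _)
  have hjt : (fun j : {j // j ≠ some i} => join s t j) = t := funext fun j => join_of_ne j.2 _ _
  refine ⟨join s t, ⟨join_mem_reach hs ht, fun r hr => ?_⟩, hjt⟩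
  rw [hjt]
  exact hmax _ ⟨r, hr, rfl⟩

open Classical in
/-- Conjectures that are revised, by means of `f`, only at those histories that contradict the
previous conjecture. -/
noncomputable def conjecture (f : E.Node c o₀ N → E.Profile c o₀ N) :
    ∀ (k : ℕ) (_ : k < N), E.Hist c o₀ k → E.Profile c o₀ N
  | 0, hk, x => f ⟨⟨0, hk⟩, x⟩
  | k + 1, hk, x =>
    let p := conjecture f k (Nat.lt_of_succ_lt hk) (Sigma.fst (x : (histAux E c o₀ (k + 1)).1))
    if p ∈ reach ⟨⟨k + 1, hk⟩, x⟩ then p else f ⟨⟨k + 1, hk⟩, x⟩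

/-- A profile is never contradicted along its own path, so once adopted there it is kept. -/
theorem conjecture_step {f : E.Node c o₀ N → E.Profile c o₀ N} {p : E.Profile c o₀ N} {k : ℕ}
    (hk : k + 1 < N)
    (h : conjecture f k (Nat.lt_of_succ_lt hk) (path p k (Nat.lt_of_succ_lt hk).le) = p) :
    conjecture f (k + 1) hk (path p (k + 1) hk.le) = p := by
  have h' : conjecture f k (Nat.lt_of_succ_lt hk)
      (Sigma.fst (path p (k + 1) hk.le : (histAux E c o₀ (k + 1)).1)) = p := h
  have hp : p ∈ reach ⟨⟨k + 1, hk⟩, path p (k + 1) hk.le⟩ := rfl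
  simp only [conjecture]
  rw [h', if_pos hp]

/-- A property of conjectures that is preserved as long as they are not contradicted. -/
theorem conjecture_induction {f : E.Node c o₀ N → E.Profile c o₀ N}
    {P : E.Node c o₀ N → E.Profile c o₀ N → Prop} (hf : ∀ h, P h (f h))
    (hP : ∀ (k : ℕ) (hk : k + 1 < N) (p : E.Profile c o₀ N),
      P ⟨⟨k, Nat.lt_of_succ_lt hk⟩, path p k (Nat.lt_of_succ_lt hk).le⟩ p →
        P ⟨⟨k + 1, hk⟩, path p (k + 1) hk.le⟩ p) :
    ∀ (k : ℕ) (hk : k < N) (x : E.Hist c o₀ k), P ⟨⟨k, hk⟩, x⟩ (conjecture f k hk x)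
  | 0, hk, x => hf _
  | k + 1, hk, x => by
    have ih := conjecture_induction hf hP k (Nat.lt_of_succ_lt hk)
      (Sigma.fst (x : (histAux E c o₀ (k + 1)).1))
    simp only [conjecture]
    split_ifs with h
    · generalize conjecture f k (Nat.lt_of_succ_lt hk)
        (Sigma.fst (x : (histAux E c o₀ (k + 1)).1)) = p at ih h
      have hx : path p (k + 1) hk.le = x := h
      subst hx
      exact hP k hk p ih
    · exact hf _

/-- The strategy of `i` that at every history follows the current conjecture. -/
noncomputable def follow (f : E.Node c o₀ N → E.Profile c o₀ N) (i : Option I) :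
    E.Strat c o₀ N i :=
  Quotient.mk _ fun h => Quotient.out (conjecture f h.1 h.1.2 h.2 i) h

/-- Against the conjecture at a history `h` that it reaches, the strategy `follow f i` does the same
as the conjectured strategy of `i`. -/
theorem zeta_join_follow {f : E.Node c o₀ N → E.Profile c o₀ N} {i : Option I} {k : ℕ} (hk : k < N)
    {p : E.Profile c o₀ N} (hc : conjecture f k hk (path p k hk.le) = p)
    (hs : follow f i ∈ reachOwn i ⟨⟨k, hk⟩, path p k hk.le⟩) :
    zeta (join (follow f i) fun j : {j // j ≠ i} => p j) = zeta p := by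
  classical
  set q := join (follow f i) fun j : {j // j ≠ i} => p j with hq
  have hqk : path q k hk.le = path p k hk.le := join_mem_reach hs ⟨p, rfl, rfl⟩
  -- `path` uses arbitrary representatives; `w` substitutes the explicit plan defining `follow f i`,
  -- which is behaviorally equivalent to the chosen one.
  let w : ∀ j, E.StdStrat c o₀ N j := Function.update (fun j => Quotient.out (p j)) i
    fun h => Quotient.out (conjecture f h.1 h.1.2 h.2 i) h
  have hw : (fun j => (Quotient.mk _ (w j) : E.Strat c o₀ N j)) = q := by
    funext j
    by_cases hj : j = i
    · subst hj
      rw [hq, join_self]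
      simp [w, follow]
    · rw [hq, join_of_ne hj]
      simp only [w, Function.update_of_ne hj]
      exact Quotient.out_eq (p j)
  have hpath : ∀ (l : ℕ) (hl : l ≤ N), path q l hl = play w l hl := fun l hl => by
    rw [← hw, path_mk]
  -- Before stage `k` agreement comes from `hs`. From then on the conjecture stays `p` on the path,
  -- so the plan of `i` prescribes the action in `p`.
  have key : ∀ (l : ℕ) (_ : k ≤ l) (hl : l ≤ N), play w l hl = path p l hl ∧
      ∀ hl' : l < N, conjecture f l hl' (path p l hl) = p := by
    intro l hkl
    induction l, hkl using Nat.le_induction with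
    | base => exact fun hl => ⟨(hpath k hl).symm.trans hqk, fun _ => hc⟩
    | succ l hkl ih =>
      intro hl
      obtain ⟨h₁, h₂⟩ := ih (Nat.le_of_succ_le hl)
      refine ⟨?_, fun hl' => conjecture_step hl' (h₂ _)⟩
      refine (play_succ_eq_iff hl).2 ⟨h₁, fun j => ?_⟩
      by_cases hj : j = i
      · subst hj
        have h₃ := h₂ hl
        simp only [w, Function.update_self]
        simp only [path] at h₃
        rw [h₃]
      · simp [w, hj]
  exact (hpath N le_rfl).trans (key N hk.le le_rfl).1

/-! ### Survival of the rounds of elimination. -/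

theorem reduce_subset (R : ∀ j, Set (E.Strat c o₀ N j)) : reduce R ≤ R := by
  intro j
  cases j with
  | none => exact le_rfl
  | some i => exact fun s hs => hs.1

theorem icbdStep_antitone : Antitone (icbdStep E c o₀ N) :=
  antitone_nat_of_succ_le fun _ => reduce_subset _

theorem restrictOthers_mono {R R' : ∀ j, Set (E.Strat c o₀ N j)} (hR : R ≤ R') (i : Option I)
    (h : E.Node c o₀ N) : restrictOthers R i h ⊆ restrictOthers R' i h :=
  fun _ ht => ⟨fun j hj => hR _ (ht.1 j hj), ht.2⟩

/-- At every history there is a profile of the others that survives as many rounds, up to `n`, as is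
compatible with the history. -/
theorem exists_mem_restrictOthers [Finite I] [Finite O] (i : Option I) (h : E.Node c o₀ N) (n : ℕ) :
    ∃ t ∈ reachOthers i h, ∀ m ≤ n, (restrictOthers (icbdStep E c o₀ N m) i h).Nonempty →
      t ∈ restrictOthers (icbdStep E c o₀ N m) i h := by
  induction n with
  | zero =>
    obtain ⟨p, hp⟩ := reach_nonempty h
    refine ⟨fun j => p j, ⟨p, hp, rfl⟩, fun m hm _ => ?_⟩
    obtain rfl := Nat.le_zero.1 hm
    exact ⟨fun _ _ => trivial, p, hp, rfl⟩
  | succ n ih =>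
    -- Survivor sets are nested: a profile compatible with round `n + 1` serves all earlier rounds.
    -- If there is none, the previous choice still works.
    by_cases hne : (restrictOthers (icbdStep E c o₀ N (n + 1)) i h).Nonempty
    · obtain ⟨t, ht⟩ := hne
      exact ⟨t, ht.2, fun m hm _ => restrictOthers_mono (icbdStep_antitone hm) i h ht⟩
    · obtain ⟨t, ht, hm⟩ := ih
      refine ⟨t, ht, fun m hmn hne' => ?_⟩
      rcases Nat.le_succ_iff.1 hmn with hmn | rfl
      · exact hm m hmn hne'
      · exact absurd hne' hne

/-- The singleton of the conjectured opponents is an admissible product set, and weak dominance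
against it would be a strict improvement on an optimal reply. Optimality among all strategies
reaching `h` covers whichever of them are left in `R`. -/
theorem not_mem_bDominated_of_optimalAt {i : I} {h : E.Node c o₀ N} {p : E.Profile c o₀ N}
    {R : ∀ j, Set (E.Strat c o₀ N j)} {s : E.Strat c o₀ N (some i)} (hp : OptimalAt i h p)
    (hR : (fun j : {j // j ≠ some i} => p j) ∈ restrictOthers R (some i) h)
    (hs : zeta (join s fun j : {j // j ≠ some i} => p j) = zeta p) :
    s ∉ bDominated i (restrictOwn R (some i) h) (restrictOthers R (some i) h) := by
  rintro ⟨hsR, hdom⟩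
  have hQ : (Set.univ.pi fun j : {j // j ≠ some i} => ({p j} : Set (E.Strat c o₀ N j))) =
      {fun j : {j // j ≠ some i} => p j} := Set.univ_pi_singleton _
  refine hdom (fun j => {p j}) ?_ ?_ ⟨hsR, ?_⟩
  · rw [hQ]; exact Set.singleton_nonempty _
  · rw [hQ]; exact Set.singleton_subset_iff.2 hR
  · rintro r hr ⟨-, t, ht, -, hnot⟩
    rw [hQ] at ht
    obtain rfl := ht
    rw [hs] at hnot
    exact hnot (hp.2 r hr.2)

/-- Every player has a strategy that survives `n` rounds of elimination. -/
theorem icbdStep_nonempty [Finite I] [Finite O] (n : ℕ) (j : Option I) :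
    (icbdStep E c o₀ N n j).Nonempty := by
  cases j with
  | none =>
    have h : ∀ m, icbdStep E c o₀ N m none = Set.univ := by
      intro m
      induction m with
      | zero => rfl
      | succ m ih => exact ih
    rw [h]
    exact Set.univ_nonempty
  | some i =>
    -- Requiring this for all `m ≤ n` at once lets a single strategy pass every round.
    let P : E.Node c o₀ N → E.Profile c o₀ N → Prop := fun h p => OptimalAt i h p ∧
      ∀ m ≤ n, (restrictOthers (icbdStep E c o₀ N m) (some i) h).Nonempty →
        (fun j : {j // j ≠ some i} => p j) ∈ restrictOthers (icbdStep E c o₀ N m) (some i) h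
    have hex : ∀ h, ∃ p, P h p := by
      intro h
      obtain ⟨t, ht, hm⟩ := exists_mem_restrictOthers (some i) h n
      obtain ⟨p, hp, rfl⟩ := exists_optimalAt i ht
      exact ⟨p, hp, hm⟩
    choose f hf using hex
    have hreach : ∀ (k : ℕ) (hk : k + 1 < N) (x : E.Hist c o₀ (k + 1)),
        reach ⟨⟨k + 1, hk⟩, x⟩ ⊆ reach (E := E) ⟨⟨k, Nat.lt_of_succ_lt hk⟩,
          Sigma.fst (x : (histAux E c o₀ (k + 1)).1)⟩ :=
      fun k hk x q hq => congrArg (fun y : (histAux E c o₀ (k + 1)).1 => y.1) hq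
    -- Reaching a longer history is more restrictive. So `p` stays optimal, and any round still
    -- compatible with the longer history was compatible with the shorter one.
    have hP := conjecture_induction hf (P := P) fun k hk p hp => by
      refine ⟨⟨rfl, fun r hr => hp.1.2 r (Set.image_mono (hreach k hk _) hr)⟩, fun m hm hne => ?_⟩
      have := hp.2 m hm
        (hne.mono fun t ht => ⟨ht.1, Set.image_mono (hreach k hk _) ht.2⟩)
      exact ⟨this.1, p, rfl, rfl⟩
    have hsurv : ∀ m ≤ n, follow f (some i) ∈ icbdStep E c o₀ N m (some i) := by
      intro m
      induction m with
      | zero => exact fun _ => trivial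
      | succ m ih =>
        -- Passing from round `m` to `m + 1` tests against opponents surviving `m` rounds; at
        -- histories where such opponents exist, the conjecture consists of them.
        refine fun hm => ⟨ih (Nat.le_of_succ_le hm), fun h hs hne => ?_⟩
        obtain ⟨⟨k, hk⟩, x⟩ := h
        have hx := hP k hk x
        generalize hc : conjecture f k hk x = p at hx
        have hpx : path p k hk.le = x := hx.1.1
        subst hpx
        exact not_mem_bDominated_of_optimalAt hx.1
          (hx.2 m (Nat.le_of_succ_le hm) hne.snd) (zeta_join_follow hk hc hs)
    exact ⟨_, hsurv n le_rfl⟩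

/-! ### Passage to the limit by finiteness. -/

theorem icbd_nonempty [Finite I] [Finite O] : (E.icbd c o₀ N).Nonempty := by
  have hj : ∀ j, (⋂ n, icbdStep E c o₀ N n j).Nonempty := by
    intro j
    by_contra hne
    have h : ∀ s, ∀ᶠ n in Filter.atTop, s ∉ icbdStep E c o₀ N n j := by
      intro s
      by_contra hs
      refine hne ⟨s, Set.mem_iInter.2 fun n => by_contra fun hn => hs ?_⟩
      exact Filter.eventually_atTop.2 ⟨n, fun m hm hsm => hn (icbdStep_antitone hm j hsm)⟩
    -- Finitely many strategies, each eventually eliminated, would all be gone at a common round.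
    obtain ⟨n, hn⟩ := (Filter.eventually_all.2 h).exists
    obtain ⟨s, hs⟩ := icbdStep_nonempty (E := E) (c := c) (o₀ := o₀) (N := N) n j
    exact hn s hs
  choose s hs using hj
  exact ⟨s, Set.mem_iInter.2 fun n j _ => Set.mem_iInter.1 (hs j) n⟩

theorem icbdOutcomes_nonempty [Finite I] [Finite O] (k : ℕ) :
    (E.icbdOutcomes c o₀ k).Nonempty :=
  (icbd_nonempty.image _).image _

end SocialEnvironment

theorem mainTheorem11 {I : Type*} {O : Type*} [Finite I] [Finite O]
    (E : SocialEnvironment I O) (c : NoMoveRule) (o₀ : O) :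
    (E.sociallyRationalizable c o₀).Nonempty := by
  by_contra hne
  have h : ∀ o, ∀ᶠ k in Filter.atTop, o ∉ E.icbdOutcomes c o₀ k := by
    intro o
    by_contra ho
    exact hne ⟨o, Filter.mem_limsup_iff_frequently_mem.2 ho⟩
  -- Likewise, finitely many outcomes would all be absent for a common `k`.
  obtain ⟨k, hk⟩ := (Filter.eventually_all.2 h).exists
  obtain ⟨o, ho⟩ := SocialEnvironment.icbdOutcomes_nonempty (E := E) (c := c) (o₀ := o₀) k
  exact hk o ho
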